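/- Let $n\ge 1$. A convex body in $\mathbb R^n$ is a compact convex set with non-empty interior, and $|\cdot|$ denotes Lebesgue measure in the relevant dimension (counting measure in dimension $0$). For convex bodies $K,L\subset\mathbb R^n$ put $$M(K,L)=\max_{z\in\mathbb R^n}|K\cap(z-L)|,\qquad K+_{n,\theta}L=\{x\in K+L:\ |K\cap(x-L)|\ge\theta\,M(K,L)\}\quad(0<\theta<1),$$ and, with the limit of sets understood in the Painlevé–Kuratowski sense (that is, a point belongs to the lower, respectively upper, limit if each of its neighbourhoods meets the sets for all $\theta<1$ close to $1$, respectively for some $\theta<1$ arbitrarily close to $1$, and the limit exists if both coincide), $$C_n(K,L)=\lim_{\theta\to1^-}\frac{K+_{n,\theta}L}{1-\theta^{1/n}}.$$ Let $\Pi^*(K)=\{x\in\mathbb R^n:\ |x|\,|P_{x^\perp}K|\le 1\}$ be the polar projection body of $K$, where $P_F$ is the orthogonal projection onto a subspace $F$. Let $E\subseteq\mathbb R^n$ be a linear subspace of dimension $k$. If $K,L$ are convex bodies, translated so that the maximum $M(K,L)$ is attained at $z=0$, i.e. $|K\cap(-L)|=M(K,L)$, then the limit $C_n(K,L)$ exists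 and $$|C_n(K,L)\cap E|\ \ge\ \binom{n+k}{n}\int_{E^\perp}\frac{|K\cap(x+E)|\,|(-L)\cap(x+E)|}{M(K,L)}\,dx$$ (the left-hand side may be $+\infty$). Moreover, for every convex body $K$ (the case $L=-K$), $$n^k|K|^k\,|\Pi^*(K)\cap E|\ \ge\ \binom{n+k}{n}\frac{|K|}{|P_{E^\perp}K|}.$$ -/

import Mathlib

open MeasureTheory Filter Topology
open scoped Pointwise ENNReal

namespace ConvolutionBody

/-- Euclidean `n`-space. -/
abbrev Space (n : ℕ) : Type := EuclideanSpace ℝ (Fin n)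

/-! ### Painlevé–Kuratowski limits of families of sets -/

/-- The lower limit: points all of whose neighbourhoods eventually meet `S i`. -/
def setLiminf {ι X : Type*} [TopologicalSpace X] (S : ι → Set X) (l : Filter ι) : Set X :=
  {x | ∀ U ∈ 𝓝 x, ∀ᶠ i in l, (S i ∩ U).Nonempty}

/-- The upper limit: points all of whose neighbourhoods frequently meet `S i`. -/
def setLimsup {ι X : Type*} [TopologicalSpace X] (S : ι → Set X) (l : Filter ι) : Set X :=
  {x | ∀ U ∈ 𝓝 x, ∃ᶠ i in l, (S i ∩ U).Nonempty}

/-- `C` is the Painlevé–Kuratowski limit of the sets `S i` along `l`. -/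
def IsSetLimit {ι X : Type*} [TopologicalSpace X] (S : ι → Set X) (l : Filter ι)
    (C : Set X) : Prop :=
  setLiminf S l = C ∧ setLimsup S l = C

/-! ### Lebesgue measure on subspaces, volumes of sections and projections -/

/-- Lebesgue measure on the linear subspace `E`, normalized so that the unit cube of an orthonormal
basis of `E` has measure one. It is spelled out because `volume` on the subtype `E` could be read as
the restriction of the `n`-dimensional measure. -/
noncomputable def subspaceVolume {n : ℕ} (E : Submodule ℝ (Space n)) : Measure E :=
  (stdOrthonormalBasis ℝ E).toBasis.addHaar

/-- `|A ∩ (x + E)|`, measured in the dimension of `E`. -/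
noncomputable def sectionVolume {n : ℕ} (E : Submodule ℝ (Space n)) (A : Set (Space n))
    (x : Space n) : ℝ≥0∞ :=
  subspaceVolume E {y : E | x + (y : Space n) ∈ A}

/-- `|P_E A|`, measured in the dimension of `E`, where `P_E` is the orthogonal projection. -/
noncomputable def projectionVolume {n : ℕ} (E : Submodule ℝ (Space n)) (A : Set (Space n)) :
    ℝ≥0∞ :=
  subspaceVolume E (E.orthogonalProjectionOnto '' A)

/-! ### Convolution bodies -/

/-- `M(K, L) = max_z |K ∩ (z - L)|`. -/
noncomputable def maxOverlap {n : ℕ} (K L : Set (Space n)) : ℝ≥0∞ :=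
  ⨆ z : Space n, volume (K ∩ ({z} - L))

/-- `K +_θ L = {x ∈ K + L : |K ∩ (x - L)| ≥ θ M(K, L)}`. -/
noncomputable def convolutionBody {n : ℕ} (K L : Set (Space n)) (θ : ℝ) : Set (Space n) :=
  {x | x ∈ K + L ∧ ENNReal.ofReal θ * maxOverlap K L ≤ volume (K ∩ ({x} - L))}

/-- `(K +_θ L) / (1 - θ^(1/n))`. -/
noncomputable def scaledConvolutionBody {n : ℕ} (K L : Set (Space n)) (θ : ℝ) : Set (Space n) :=
  (1 - θ ^ (1 / (n : ℝ)))⁻¹ • convolutionBody K L θ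

/-- `C_n(K, L)`, the limit of `(K +_θ L) / (1 - θ^(1/n))` as `θ → 1⁻`. It is defined as the lower
limit; that the limit exists is the statement
`IsSetLimit (scaledConvolutionBody K L) (𝓝[<] 1) (limitingConvolutionBody K L)`. -/
noncomputable def limitingConvolutionBody {n : ℕ} (K L : Set (Space n)) : Set (Space n) :=
  setLiminf (scaledConvolutionBody K L) (𝓝[<] (1 : ℝ))

/-- The polar projection body `Π*(K) = {x : |x| |P_{x^⊥} K| ≤ 1}`. -/
def polarProjectionBody {n : ℕ} (K : Set (Space n)) : Set (Space n) :=
  {x | ‖x‖ₑ * projectionVolume (Submodule.span ℝ {x})ᗮ K ≤ 1}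

end ConvolutionBody

open ConvolutionBody

namespace ConvolutionBody

/-! Put f(x) = |K ∩ (x - L)| / M(K, L), so that f(0) = 1. Since c(K ∩ (x - L)) + (1 - c)(K ∩ -L)
lies in K ∩ (cx - L), the Brunn–Minkowski inequality gives f(cx)^(1/n) ≥ c f(x)^(1/n) + 1 - c
(`ofReal_mul_maxOverlap_le`). Hence the rescaled bodies increase with θ
(`scaledConvolutionBody_mono`), so their limit C exists and contains each of them.

Consequently {f > θ} ∩ E lies in (1 - θ^(1/n))(C ∩ E). Integrating over θ in (0, 1), the layer cake
formula bounds ∫_E f by |C ∩ E| ∫ (1 - θ^(1/n))^k dθ, and this Beta integral is the inverse of the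
binomial coefficient. Fubini turns ∫_E f into the integral of products of sections over the
orthogonal complement of E. The argument, `choose_mul_lintegral_le`, uses only that C contains every
rescaled body.

For L = -K, it therefore suffices to place the rescaled bodies inside n|K| Π*(K); computing the
limit is unnecessary. A point x of such a body satisfies |K \ (sx + K)| ≤ s n|K| for all s > 0.
Dividing by s and letting s → 0, each line parallel to x that meets the interior of K contributes
its full share, so |x| |P_{x^⊥} K| ≤ n|K|. Cauchy–Schwarz then bounds the integral of the squared
sections from below by |K|² / |P_{E^⊥} K|. -/

/-! ### Prékopa–Leindler and Brunn–Minkowski inequalities -/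

/-- Layer cake formula for a function with values in `[0, 1]`. -/
theorem lintegral_eq_lintegral_Ioo_meas_lt {α : Type*} [MeasurableSpace α] (μ : Measure α)
    {f : α → ℝ≥0∞} (hf : Measurable f) (hf1 : ∀ a, f a ≤ 1) :
    ∫⁻ a, f a ∂μ = ∫⁻ t in Set.Ioo (0 : ℝ) 1, μ {a | ENNReal.ofReal t < f a} := by
  have hft : ∀ a, f a ≠ ∞ := fun a => ne_top_of_le_ne_top ENNReal.one_ne_top (hf1 a)
  have h1 : ∫⁻ a, f a ∂μ = ∫⁻ a, ENNReal.ofReal (f a).toReal ∂μ :=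
    lintegral_congr fun a => (ENNReal.ofReal_toReal (hft a)).symm
  have h3 : ∀ t : ℝ, 0 < t → {a | t < (f a).toReal} = {a | ENNReal.ofReal t < f a} := by
    intro t ht
    ext a
    exact (ENNReal.ofReal_lt_iff_lt_toReal ht.le (hft a)).symm
  rw [h1, lintegral_eq_lintegral_meas_lt μ (ae_of_all _ fun a => ENNReal.toReal_nonneg)
    hf.ennreal_toReal.aemeasurable, ← Set.Ioo_union_Ici_eq_Ioi (zero_lt_one' ℝ),
    lintegral_union measurableSet_Ici]
  · have h2 : ∫⁻ t in Set.Ici (1 : ℝ), μ {a | t < (f a).toReal} = 0 := by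
      refine setLIntegral_eq_zero measurableSet_Ici fun t ht => ?_
      have : {a | t < (f a).toReal} = ∅ := by
        refine Set.eq_empty_of_forall_notMem fun a ha => not_lt.2 ?_ (show t < (f a).toReal from ha)
        exact (ENNReal.toReal_mono ENNReal.one_ne_top (hf1 a)).trans (by simpa using ht)
      simp [this]
    rw [h2, add_zero]
    refine setLIntegral_congr_fun measurableSet_Ioo fun t ht => ?_
    simp only [h3 t ht.1]
  · exact Set.disjoint_left.2 fun t ht ht' => not_lt.2 ht' ht.2

theorem lintegral_Ioo_meas_lt_le {α : Type*} [MeasurableSpace α] (μ : Measure α)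
    {f : α → ℝ≥0∞} (hf : Measurable f) :
    ∫⁻ t in Set.Ioo (0 : ℝ) 1, μ {a | ENNReal.ofReal t < f a} ≤ ∫⁻ a, f a ∂μ := by
  calc _ = ∫⁻ t in Set.Ioo (0 : ℝ) 1, μ {a | ENNReal.ofReal t < min (f a) 1} := by
        refine setLIntegral_congr_fun measurableSet_Ioo fun t ht => ?_
        have : ENNReal.ofReal t < 1 := by simpa using ht.2
        simp only [lt_min_iff, this, and_true]
    _ = ∫⁻ a, min (f a) 1 ∂μ :=
        (lintegral_eq_lintegral_Ioo_meas_lt μ (hf.min measurable_const) fun a => min_le_right _ _).symm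
    _ ≤ _ := lintegral_mono fun a => min_le_left _ _

/-- With a = max A and b = min B, the translates A + b and a + B lie in A + B and can meet only at a
+ b. -/
theorem volume_add_le_of_isCompact {A B : Set ℝ} (hA : IsCompact A) (hB : IsCompact B)
    (hA0 : A.Nonempty) (hB0 : B.Nonempty) : volume A + volume B ≤ volume (A + B) := by
  obtain ⟨a, ha, ha'⟩ := hA.exists_isGreatest hA0
  obtain ⟨b, hb, hb'⟩ := hB.exists_isLeast hB0
  have h : AEDisjoint volume ((· + b) '' A) ((a + ·) '' B) := by
    refine measure_mono_null (t := {a + b}) ?_ (by simp)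
    rintro _ ⟨⟨x, hx, rfl⟩, ⟨y, hy, hxy⟩⟩
    have := ha' hx
    have := hb' hy
    simp only at hxy
    rw [Set.mem_singleton_iff]
    linarith
  calc volume A + volume B = volume ((· + b) '' A) + volume ((a + ·) '' B) := by
        congr 1
        · simp
        · simp
    _ = volume (((· + b) '' A) ∪ ((a + ·) '' B)) :=
        (measure_union₀ (hB.image (by fun_prop)).measurableSet.nullMeasurableSet h).symm
    _ ≤ volume (A + B) := by
        refine measure_mono ?_
        rintro _ (⟨x, hx, rfl⟩ | ⟨x, hx, rfl⟩)
        · exact Set.add_mem_add hx hb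
        · exact Set.add_mem_add ha hx

/-- The Brunn–Minkowski inequality on the line. -/
theorem volume_add_le_of_measurableSet {A B : Set ℝ} (hA : MeasurableSet A) (hB : MeasurableSet B)
    (hA0 : A.Nonempty) (hB0 : B.Nonempty) : volume A + volume B ≤ volume (A + B) := by
  obtain ⟨a, ha⟩ := hA0
  obtain ⟨b, hb⟩ := hB0
  rw [hA.measure_eq_iSup_isCompact, hB.measure_eq_iSup_isCompact]
  simp only [iSup_and']
  refine ENNReal.biSup_add_biSup_le' (p := fun K => K ⊆ A ∧ IsCompact K)
    (q := fun K => K ⊆ B ∧ IsCompact K) ⟨∅, by simp, isCompact_empty⟩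
    ⟨∅, by simp, isCompact_empty⟩ ?_
  rintro K ⟨hK, hKc⟩ L ⟨hL, hLc⟩
  -- Inserting a and b keeps the compact approximants nonempty.
  calc volume K + volume L ≤ volume (insert a K) + volume (insert b L) := by gcongr <;> simp
    _ ≤ volume (insert a K + insert b L) :=
      volume_add_le_of_isCompact (hKc.insert a) (hLc.insert b) (by simp) (by simp)
    _ ≤ volume (A + B) := by
      gcongr
      · exact Set.insert_subset ha hK
      · exact Set.insert_subset hb hL

theorem ennreal_geom_mean_le {a b : ℝ} (ha : 0 < a) (hb : 0 < b) (hab : a + b = 1)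
    (x y : ℝ≥0∞) : x ^ a * y ^ b ≤ ENNReal.ofReal a * x + ENNReal.ofReal b * y := by
  have hpq : (1 / a).HolderConjugate (1 / b) := by
    rw [Real.holderConjugate_iff]
    refine ⟨?_, by simpa using hab⟩
    rw [lt_div_iff₀ ha]; linarith
  have := ENNReal.young_inequality (x ^ a) (y ^ b) hpq
  rw [← ENNReal.rpow_mul, ← ENNReal.rpow_mul, mul_one_div_cancel ha.ne', mul_one_div_cancel hb.ne',
    ENNReal.rpow_one, ENNReal.rpow_one, one_div, one_div, ENNReal.ofReal_inv_of_pos ha,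
    ENNReal.ofReal_inv_of_pos hb, ENNReal.div_eq_inv_mul, ENNReal.div_eq_inv_mul, inv_inv,
    inv_inv] at this
  exact this

/-- Prékopa–Leindler on the line for functions whose suprema are one. -/
theorem arith_mean_lintegral_le {a b : ℝ} (ha : 0 < a) (hb : 0 < b) (hab : a + b = 1)
    {f g h : ℝ → ℝ≥0∞} (hf : Measurable f) (hg : Measurable g) (hh : Measurable h)
    (hf1 : ⨆ x, f x = 1) (hg1 : ⨆ x, g x = 1)
    (H : ∀ x y, f x ^ a * g y ^ b ≤ h (a * x + b * y)) :
    ENNReal.ofReal a * (∫⁻ x, f x) + ENNReal.ofReal b * (∫⁻ x, g x) ≤ ∫⁻ x, h x := by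
  rw [lintegral_eq_lintegral_Ioo_meas_lt volume hf fun x => hf1 ▸ le_iSup f x,
    lintegral_eq_lintegral_Ioo_meas_lt volume hg fun x => hg1 ▸ le_iSup g x]
  refine le_trans ?_ (lintegral_Ioo_meas_lt_le volume hh)
  rw [← lintegral_const_mul' _ _ ENNReal.ofReal_ne_top,
    ← lintegral_const_mul' _ _ ENNReal.ofReal_ne_top]
  refine (le_lintegral_add _ _).trans ?_
  refine setLIntegral_mono' measurableSet_Ioo fun t ht => ?_
  have ht1 : ENNReal.ofReal t < 1 := by simpa using ht.2
  have ht0 : ENNReal.ofReal t ≠ 0 := by simpa using ht.1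
  have hvol : ∀ {c : ℝ} (A : Set ℝ), 0 < c → ENNReal.ofReal c * volume A = volume (c • A) := by
    intro c A hc
    rw [Measure.addHaar_smul]
    simp [abs_of_pos hc]
  rw [hvol _ ha, hvol _ hb]
  have hfm : MeasurableSet {x | ENNReal.ofReal t < f x} := measurableSet_lt measurable_const hf
  have hgm : MeasurableSet {x | ENNReal.ofReal t < g x} := measurableSet_lt measurable_const hg
  -- As a + b = 1, the set a{f > t} + b{g > t} lies in {h > t}; both summands are nonempty because t
  -- < 1 = sup f = sup g.
  refine (volume_add_le_of_measurableSet (hfm.const_smul₀ a) (hgm.const_smul₀ b) ?_ ?_).trans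
    (measure_mono ?_)
  · obtain ⟨x, hx⟩ := lt_iSup_iff.1 (hf1 ▸ ht1)
    exact ⟨_, Set.smul_mem_smul_set hx⟩
  · obtain ⟨x, hx⟩ := lt_iSup_iff.1 (hg1 ▸ ht1)
    exact ⟨_, Set.smul_mem_smul_set hx⟩
  · rintro _ ⟨_, ⟨x, hx, rfl⟩, _, ⟨y, hy, rfl⟩, rfl⟩
    refine lt_of_lt_of_le ?_ (H x y)
    calc ENNReal.ofReal t = ENNReal.ofReal t ^ a * ENNReal.ofReal t ^ b := by
          rw [← ENNReal.rpow_add _ _ ht0 ENNReal.ofReal_ne_top, hab, ENNReal.rpow_one]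
      _ < f x ^ a * g y ^ b :=
          ENNReal.mul_lt_mul (ENNReal.rpow_lt_rpow hx ha) (ENNReal.rpow_lt_rpow hy hb)

/-- Dividing f, g, h by F, G and F^a G^b preserves the hypothesis and makes both suprema one; the
weighted AM–GM inequality then passes from the arithmetic to the geometric mean. -/
theorem geom_mean_lintegral_le_of_bounded {a b : ℝ} (ha : 0 < a) (hb : 0 < b) (hab : a + b = 1)
    {f g h : ℝ → ℝ≥0∞} (hf : Measurable f) (hg : Measurable g) (hh : Measurable h)
    (hf1 : ⨆ x, f x ≠ ∞) (hg1 : ⨆ x, g x ≠ ∞)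
    (H : ∀ x y, f x ^ a * g y ^ b ≤ h (a * x + b * y)) :
    (∫⁻ x, f x) ^ a * (∫⁻ x, g x) ^ b ≤ ∫⁻ x, h x := by
  set F := ⨆ x, f x with hF
  set G := ⨆ x, g x with hG
  by_cases hF0 : F = 0
  · have : f = 0 := funext fun x => le_zero_iff.1 (hF0 ▸ le_iSup f x)
    simp [this, ha]
  by_cases hG0 : G = 0
  · have : g = 0 := funext fun x => le_zero_iff.1 (hG0 ▸ le_iSup g x)
    simp [this, hb]
  set c := F ^ a * G ^ b with hc
  have hc0 : c ≠ 0 := mul_ne_zero (by simp [hF0, hf1]) (by simp [hG0, hg1])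
  have hct : c ≠ ∞ := ENNReal.mul_ne_top (by simp [hF0, hf1]) (by simp [hG0, hg1])
  have key := arith_mean_lintegral_le ha hb hab (f := fun x => F⁻¹ * f x) (g := fun x => G⁻¹ * g x)
    (h := fun x => c⁻¹ * h x) (hf.const_mul _) (hg.const_mul _) (hh.const_mul _)
    (by rw [← ENNReal.mul_iSup, ENNReal.inv_mul_cancel hF0 hf1])
    (by rw [← ENNReal.mul_iSup, ENNReal.inv_mul_cancel hG0 hg1]) (by
      intro x y
      rw [ENNReal.mul_rpow_of_nonneg _ _ ha.le, ENNReal.mul_rpow_of_nonneg _ _ hb.le,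
        mul_mul_mul_comm, ENNReal.inv_rpow, ENNReal.inv_rpow,
        ← ENNReal.mul_inv (Or.inl (by simp [hF0, hf1])) (Or.inr (by simp [hG0, hg1]))]
      gcongr
      exact H x y)
  have key2 := (ennreal_geom_mean_le ha hb hab _ _).trans key
  rw [lintegral_const_mul _ hf, lintegral_const_mul _ hg, lintegral_const_mul _ hh,
    ENNReal.mul_rpow_of_nonneg _ _ ha.le, ENNReal.mul_rpow_of_nonneg _ _ hb.le,
        mul_mul_mul_comm, ENNReal.inv_rpow, ENNReal.inv_rpow,
        ← ENNReal.mul_inv (Or.inl (by simp [hF0, hf1])) (Or.inr (by simp [hG0, hg1]))] at key2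
  exact (ENNReal.mul_le_mul_iff_right (ENNReal.inv_ne_zero.2 hct) (ENNReal.inv_ne_top.2 hc0)).1 key2

/-- The Prékopa–Leindler inequality on the line. -/
theorem geom_mean_lintegral_le_real {a b : ℝ} (ha : 0 < a) (hb : 0 < b) (hab : a + b = 1)
    {f g h : ℝ → ℝ≥0∞} (hf : Measurable f) (hg : Measurable g) (hh : Measurable h)
    (H : ∀ x y, f x ^ a * g y ^ b ≤ h (a * x + b * y)) :
    (∫⁻ x, f x) ^ a * (∫⁻ x, g x) ^ b ≤ ∫⁻ x, h x := by
  have hlim : ∀ {f : ℝ → ℝ≥0∞}, Measurable f →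
      Tendsto (fun N : ℕ => ∫⁻ x, min (f x) N) atTop (𝓝 (∫⁻ x, f x)) := by
    intro f hf
    refine lintegral_tendsto_of_tendsto_of_monotone (fun N => (hf.min measurable_const).aemeasurable)
      (ae_of_all _ fun x N N' hN => min_le_min le_rfl (by exact_mod_cast hN)) (ae_of_all _ fun x => ?_)
    simpa using (tendsto_const_nhds (x := f x)).min ENNReal.tendsto_nat_nhds_top
  -- Truncating f and g only lowers the left side of the hypothesis, so h need not change.
  have hbd : ∀ N : ℕ, (∫⁻ x, min (f x) N) ^ a * (∫⁻ x, min (g x) N) ^ b ≤ ∫⁻ x, h x := by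
    intro N
    have hN : ∀ f : ℝ → ℝ≥0∞, ⨆ x, min (f x) N ≠ ∞ := fun f =>
      ne_top_of_le_ne_top (ENNReal.natCast_ne_top N) (iSup_le fun x => min_le_right _ _)
    refine geom_mean_lintegral_le_of_bounded ha hb hab (hf.min measurable_const)
      (hg.min measurable_const) hh (hN f) (hN g) fun x y => le_trans ?_ (H x y)
    gcongr <;> exact min_le_left _ _
  by_cases hf0 : ∫⁻ x, f x = 0
  · simp [hf0, ha]
  by_cases hg0 : ∫⁻ x, g x = 0
  · simp [hg0, hb]
  refine le_of_tendsto' (ENNReal.Tendsto.mul ((hlim hf).ennrpow_const a) (Or.inl ?_)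
    ((hlim hg).ennrpow_const b) (Or.inl ?_)) hbd
  · simp [hf0, ha, ha.not_gt]
  · simp [hg0, hb, hb.not_gt]

/-- The Prékopa–Leindler inequality. -/
theorem geom_mean_lintegral_le {a b : ℝ} (ha : 0 < a) (hb : 0 < b) (hab : a + b = 1) (n : ℕ)
    {f g h : (Fin n → ℝ) → ℝ≥0∞} (hf : Measurable f) (hg : Measurable g) (hh : Measurable h)
    (H : ∀ x y, f x ^ a * g y ^ b ≤ h (a • x + b • y)) :
    (∫⁻ x, f x) ^ a * (∫⁻ x, g x) ^ b ≤ ∫⁻ x, h x := by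
  induction n with
  | zero =>
    have h0 : ∀ f : (Fin 0 → ℝ) → ℝ≥0∞, ∫⁻ x, f x = f 0 := by
      intro f
      rw [volume_pi, Measure.pi_of_empty (x := 0), lintegral_dirac]
    simpa [h0] using H 0 0
  | succ n ih =>
    have hsplit : ∀ f : (Fin (n + 1) → ℝ) → ℝ≥0∞, Measurable f →
        ∫⁻ x, f x = ∫⁻ s : ℝ, ∫⁻ y : Fin n → ℝ, f (Fin.cons s y) := by
      intro f hf
      have e := (volume_preserving_piFinSuccAbove (fun _ : Fin (n + 1) => ℝ) 0).symm
      rw [← e.lintegral_comp hf, Measure.volume_eq_prod, lintegral_prod _ (by fun_prop)]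
      simp [MeasurableEquiv.piFinSuccAbove, Fin.insertNthEquiv]
    have hcons : Measurable fun p : ℝ × (Fin n → ℝ) => (Fin.cons p.1 p.2 : Fin (n + 1) → ℝ) := by
      refine measurable_pi_iff.2 fun i => ?_
      refine Fin.cases ?_ (fun j => ?_) i
      · simpa using measurable_fst
      · simp only [Fin.cons_succ]; fun_prop
    rw [hsplit f hf, hsplit g hg, hsplit h hh]
    -- The integrals over slices with fixed first coordinate satisfy the one-dimensional hypothesis,
    -- by induction.
    refine geom_mean_lintegral_le_real ha hb hab (hf.comp hcons).lintegral_prod_right'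
      (hg.comp hcons).lintegral_prod_right' (hh.comp hcons).lintegral_prod_right' fun s t => ?_
    refine ih (hf.comp (hcons.comp measurable_prodMk_left))
      (hg.comp (hcons.comp measurable_prodMk_left)) (hh.comp (hcons.comp measurable_prodMk_left))
      fun x y => ?_
    refine (H _ _).trans_eq ?_
    congr 1
    ext i
    refine Fin.cases ?_ (fun j => ?_) i <;> simp

theorem volume_smul_space {n : ℕ} {r : ℝ} (hr : 0 ≤ r) (A : Set (Space n)) :
    volume (r • A) = ENNReal.ofReal (r ^ n) * volume A := by
  rw [Measure.addHaar_smul]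
  simp [abs_of_nonneg, pow_nonneg hr]

/-- The multiplicative Brunn–Minkowski inequality for compact sets. -/
theorem one_le_volume_convex_comb {n : ℕ} {a b : ℝ} (ha : 0 < a) (hb : 0 < b) (hab : a + b = 1)
    {A B : Set (Space n)} (hA : IsCompact A) (hB : IsCompact B)
    (hA1 : 1 ≤ volume A) (hB1 : 1 ≤ volume B) : 1 ≤ volume (a • A + b • B) := by
  have hc : ∀ {A : Set (Space n)}, IsCompact A → ∫⁻ x : Fin n → ℝ,
      A.indicator 1 (WithLp.toLp 2 x) = volume A := by
    intro A hA
    rw [(PiLp.volume_preserving_toLp (Fin n)).lintegral_comp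
      (measurable_one.indicator hA.measurableSet), lintegral_indicator_one hA.measurableSet]
  have hm : ∀ {A : Set (Space n)}, IsCompact A →
      Measurable fun x : Fin n → ℝ => A.indicator (1 : Space n → ℝ≥0∞) (WithLp.toLp 2 x) := by
    intro A hA
    exact (measurable_one.indicator hA.measurableSet).comp
      (PiLp.volume_preserving_toLp (Fin n)).measurable
  have hAB : IsCompact (a • A + b • B) := (hA.smul a).add (hB.smul b)
  have := geom_mean_lintegral_le ha hb hab n (hm hA) (hm hB) (hm hAB) (by
    intro x y
    by_cases hx : WithLp.toLp 2 x ∈ A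
    · by_cases hy : WithLp.toLp 2 y ∈ B
      · have : a • WithLp.toLp 2 x + b • WithLp.toLp 2 y ∈ a • A + b • B :=
          Set.add_mem_add (Set.smul_mem_smul_set hx) (Set.smul_mem_smul_set hy)
        simp [hx, hy, this]
      · simp [hy, hb]
    · simp [hx, ha])
  rw [hc hA, hc hB, hc hAB] at this
  refine le_trans ?_ this
  calc (1 : ℝ≥0∞) = 1 ^ a * 1 ^ b := by simp
    _ ≤ _ := by gcongr

/-- The Brunn–Minkowski inequality for compact sets. -/
theorem add_pow_le_volume_add {n : ℕ} {α β : ℝ} (hα : 0 < α) (hβ : 0 < β)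
    {A B : Set (Space n)} (hA : IsCompact A) (hB : IsCompact B)
    (hA1 : ENNReal.ofReal (α ^ n) ≤ volume A) (hB1 : ENNReal.ofReal (β ^ n) ≤ volume B) :
    ENNReal.ofReal ((α + β) ^ n) ≤ volume (A + B) := by
  have hs : 0 < α + β := add_pos hα hβ
  have h1 : ∀ {γ : ℝ} {A : Set (Space n)}, 0 < γ → ENNReal.ofReal (γ ^ n) ≤ volume A →
      1 ≤ volume (γ⁻¹ • A) := by
    intro γ A hγ h
    rw [volume_smul_space (inv_nonneg.2 hγ.le)]
    calc (1 : ℝ≥0∞) = ENNReal.ofReal (γ⁻¹ ^ n) * ENNReal.ofReal (γ ^ n) := by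
          rw [← ENNReal.ofReal_mul (by positivity), ← mul_pow, inv_mul_cancel₀ hγ.ne']; simp
      _ ≤ _ := by gcongr
  -- Both sets are normalized to volume at least one; the weights α/(α+β) and β/(α+β) reassemble A +
  -- B up to the factor α + β.
  have key := one_le_volume_convex_comb (div_pos hα hs) (div_pos hβ hs)
    (by field_simp) (hA.smul α⁻¹) (hB.smul β⁻¹) (h1 hα hA1) (h1 hβ hB1)
  have he : A + B = (α + β) • ((α / (α + β)) • α⁻¹ • A + (β / (α + β)) • β⁻¹ • B) := by
    rw [smul_add, smul_smul, smul_smul, smul_smul, smul_smul]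
    have e1 : (α + β) * (α / (α + β) * α⁻¹) = 1 := by field_simp
    have e2 : (α + β) * (β / (α + β) * β⁻¹) = 1 := by field_simp
    rw [← mul_assoc] at e1 e2
    simp only [e1, e2, one_smul]
  rw [he, volume_smul_space hs.le]
  calc ENNReal.ofReal ((α + β) ^ n) = ENNReal.ofReal ((α + β) ^ n) * 1 := (mul_one _).symm
    _ ≤ _ := by gcongr

/-! ### Overlap volumes and monotonicity of the rescaled bodies -/

theorem mem_singleton_sub {X : Type*} [AddCommGroup X] {L : Set X} {x z : X} :
    z ∈ ({x} : Set X) - L ↔ x - z ∈ L := by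
  constructor
  · rintro ⟨_, rfl, l, hl, rfl⟩
    simpa using hl
  · intro h
    exact ⟨x, rfl, x - z, h, by simp⟩

theorem isCompact_overlap {n : ℕ} {K L : Set (Space n)} (hK : IsCompact K) (hL : IsCompact L)
    (x : Space n) : IsCompact (K ∩ ({x} - L)) :=
  hK.inter (sub_eq_add_neg {x} L ▸ isCompact_singleton.add hL.neg)

theorem maxOverlap_ne_top {n : ℕ} {K : Set (Space n)} (hK : IsCompact K) (L : Set (Space n)) :
    maxOverlap K L ≠ ∞ :=
  ne_top_of_le_ne_top hK.measure_ne_top (iSup_le fun _ => measure_mono Set.inter_subset_left)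

theorem maxOverlap_pos {n : ℕ} {K L : Set (Space n)} (hK : (interior K).Nonempty)
    (hL : (interior L).Nonempty) : 0 < maxOverlap K L := by
  obtain ⟨a, ha⟩ := hK
  obtain ⟨b, hb⟩ := hL
  have hopen : IsOpen (interior K ∩ (fun z => a + b - z) ⁻¹' interior L) :=
    isOpen_interior.inter (isOpen_interior.preimage (by fun_prop))
  refine (hopen.measure_pos volume ⟨a, ha, by simpa using hb⟩).trans_le
    (le_trans (measure_mono ?_) 
      (le_iSup (fun z => volume (K ∩ ({z} - L))) (a + b)))
  exact fun z hz => ⟨interior_subset hz.1, mem_singleton_sub.2 (interior_subset hz.2)⟩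

/-- Positive overlap already forces x ∈ K + L. -/
theorem mem_convolutionBody_iff {n : ℕ} {K L : Set (Space n)} (hM : maxOverlap K L ≠ 0) {θ : ℝ}
    (hθ : 0 < θ) {x : Space n} : x ∈ convolutionBody K L θ ↔
      ENNReal.ofReal θ * maxOverlap K L ≤ volume (K ∩ ({x} - L)) := by
  refine ⟨fun h => h.2, fun h => ⟨?_, h⟩⟩
  have hpos : volume (K ∩ ({x} - L)) ≠ 0 := by
    intro h0
    rw [h0, le_zero_iff, mul_eq_zero, ENNReal.ofReal_eq_zero] at h
    exact h.elim (fun h => absurd h hθ.not_ge) hM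
  obtain ⟨z, hz, hz'⟩ := nonempty_of_measure_ne_zero hpos
  exact ⟨z, hz, x - z, mem_singleton_sub.1 hz', by simp⟩

theorem convex_comb_overlap_subset {n : ℕ} {K L : Set (Space n)} (hK : Convex ℝ K)
    (hL : Convex ℝ L) {c : ℝ} (hc0 : 0 ≤ c) (hc1 : c ≤ 1) (x : Space n) :
    c • (K ∩ ({x} - L)) + (1 - c) • (K ∩ -L) ⊆ K ∩ ({c • x} - L) := by
  rintro _ ⟨_, ⟨y, ⟨hy, hy'⟩, rfl⟩, _, ⟨z, ⟨hz, hz'⟩, rfl⟩, rfl⟩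
  refine ⟨hK hy hz hc0 (sub_nonneg.2 hc1) (by ring), mem_singleton_sub.2 ?_⟩
  convert hL (mem_singleton_sub.1 hy') (Set.mem_neg.1 hz') hc0 (sub_nonneg.2 hc1) (by ring) using 1
  simp only [smul_sub, smul_neg]
  abel

/-- The `n`-th root of the overlap volume is concave along rays from a maximal point. -/
theorem ofReal_mul_maxOverlap_le {n : ℕ} (hn : n ≠ 0) {K L : Set (Space n)} (hK : IsCompact K)
    (hL : IsCompact L) (hKc : Convex ℝ K) (hLc : Convex ℝ L) (hM0 : maxOverlap K L ≠ 0)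
    (hM : volume (K ∩ -L) = maxOverlap K L) {c r : ℝ} (hc0 : 0 < c) (hc1 : c < 1) (hr : 0 < r)
    {x : Space n} (hx : ENNReal.ofReal (r ^ n) * maxOverlap K L ≤ volume (K ∩ ({x} - L))) :
    ENNReal.ofReal ((c * r + (1 - c)) ^ n) * maxOverlap K L ≤ volume (K ∩ ({c • x} - L)) := by
  have hMt : maxOverlap K L ≠ ∞ := maxOverlap_ne_top hK L
  set m := (maxOverlap K L).toReal with hm
  have hm0 : 0 < m := ENNReal.toReal_pos hM0 hMt
  have hMm : maxOverlap K L = ENNReal.ofReal m := (ENNReal.ofReal_toReal hMt).symm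
  set q := m ^ (1 / (n : ℝ)) with hq
  have hq0 : 0 < q := Real.rpow_pos_of_pos hm0 _
  have hqn : q ^ n = m := by
    rw [hq, one_div]
    exact Real.rpow_inv_natCast_pow hm0.le hn
  have h1c : 0 < 1 - c := sub_pos.2 hc1
  -- With q = M^(1/n), the two radii add up to (cr + 1 - c) q.
  have key := add_pow_le_volume_add (n := n) (α := c * (r * q)) (β := (1 - c) * q)
    (by positivity) (by positivity) ((isCompact_overlap hK hL x).smul c)
    ((hK.inter hL.neg).smul (1 - c)) (by
      rw [volume_smul_space hc0.le, mul_pow, mul_pow, hqn,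
        ENNReal.ofReal_mul (by positivity)]
      gcongr
      rwa [ENNReal.ofReal_mul (by positivity), ← hMm]) (by
      rw [volume_smul_space h1c.le, mul_pow, hqn, ENNReal.ofReal_mul (by positivity), ← hMm, hM])
  refine le_trans (le_of_eq ?_)
    (key.trans (measure_mono (convex_comb_overlap_subset hKc hLc hc0.le hc1.le x)))
  rw [hMm, ← ENNReal.ofReal_mul (by positivity), ← hqn, ← mul_pow]
  congr 2
  ring

theorem rpow_one_div_lt_one {n : ℕ} (hn : n ≠ 0) {θ : ℝ} (h0 : 0 < θ) (h1 : θ < 1) :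
    θ ^ (1 / (n : ℝ)) < 1 :=
  Real.rpow_lt_one h0.le h1 (by positivity)

theorem rpow_one_div_pow {n : ℕ} (hn : n ≠ 0) {θ : ℝ} (h0 : 0 < θ) :
    (θ ^ (1 / (n : ℝ))) ^ n = θ := by
  rw [one_div]
  exact Real.rpow_inv_natCast_pow h0.le hn

/-- The rescaled convolution bodies increase with `θ`. -/
theorem scaledConvolutionBody_mono {n : ℕ} (hn : n ≠ 0) {K L : Set (Space n)} (hK : IsCompact K)
    (hL : IsCompact L) (hKc : Convex ℝ K) (hLc : Convex ℝ L) (hM0 : maxOverlap K L ≠ 0)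
    (hM : volume (K ∩ -L) = maxOverlap K L) {θ θ' : ℝ} (h0 : 0 < θ) (h : θ < θ') (h1 : θ' < 1) :
    scaledConvolutionBody K L θ ⊆ scaledConvolutionBody K L θ' := by
  rintro _ ⟨w, hw, rfl⟩
  have hr : 0 < 1 - θ ^ (1 / (n : ℝ)) := sub_pos.2 (rpow_one_div_lt_one hn h0 (h.trans h1))
  have hr' : 0 < 1 - θ' ^ (1 / (n : ℝ)) := sub_pos.2 (rpow_one_div_lt_one hn (h0.trans h) h1)
  have hrr : θ ^ (1 / (n : ℝ)) < θ' ^ (1 / (n : ℝ)) :=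
    Real.rpow_lt_rpow h0.le h (by positivity)
  have hp : (θ ^ (1 / (n : ℝ))) ^ n = θ := rpow_one_div_pow hn h0
  have hp' : (θ' ^ (1 / (n : ℝ))) ^ n = θ' := rpow_one_div_pow hn (h0.trans h)
  have hpos : 0 < θ ^ (1 / (n : ℝ)) := Real.rpow_pos_of_pos h0 _
  set r := θ ^ (1 / (n : ℝ)) with hrdef
  set r' := θ' ^ (1 / (n : ℝ)) with hrdef'
  -- The factor c = (1 - r')/(1 - r) solves cr + (1 - c) = r', and it also makes the two rescaled
  -- points coincide.
  refine ⟨((1 - r') / (1 - r)) • w, ?_, ?_⟩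
  · rw [mem_convolutionBody_iff hM0 (h0.trans h)]
    have := ofReal_mul_maxOverlap_le hn hK hL hKc hLc hM0 hM (c := (1 - r') / (1 - r)) (r := r)
      (div_pos hr' hr) ((div_lt_one hr).2 (by linarith)) hpos (x := w) (by
        rw [hp]; exact hw.2)
    have he : (1 - r') / (1 - r) * r + (1 - (1 - r') / (1 - r)) = r' := by
      field_simp
      ring
    rwa [he, hp'] at this
  · simp only [← hrdef', smul_smul]
    congr 1
    field_simp

/-! ### Limits of increasing families of sets -/

theorem eventually_mem_Ioo_zero_one : ∀ᶠ θ : ℝ in 𝓝[<] (1 : ℝ), θ ∈ Set.Ioo (0 : ℝ) 1 :=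
  Ioo_mem_nhdsLT zero_lt_one

/-- An increasing family of sets has a Painlevé–Kuratowski limit. -/
theorem isSetLimit_of_mono {X : Type*} [TopologicalSpace X] {S : ℝ → Set X}
    (hS : ∀ ⦃θ θ' : ℝ⦄, 0 < θ → θ < θ' → θ' < 1 → S θ ⊆ S θ') :
    IsSetLimit S (𝓝[<] (1 : ℝ)) (setLiminf S (𝓝[<] (1 : ℝ))) := by
  refine ⟨rfl, Set.Subset.antisymm (fun x hx U hU => ?_) fun x hx U hU => (hx U hU).frequently⟩
  obtain ⟨θ, ⟨y, hy⟩, hθ⟩ := ((hx U hU).and_eventually eventually_mem_Ioo_zero_one).exists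
  filter_upwards [Ioo_mem_nhdsLT hθ.2] with θ' hθ'
  exact ⟨y, hS hθ.1 hθ'.1 hθ'.2 hy.1, hy.2⟩

theorem subset_setLiminf_of_mono {X : Type*} [TopologicalSpace X] {S : ℝ → Set X}
    (hS : ∀ ⦃θ θ' : ℝ⦄, 0 < θ → θ < θ' → θ' < 1 → S θ ⊆ S θ') {θ : ℝ} (h0 : 0 < θ) (h1 : θ < 1) :
    S θ ⊆ setLiminf S (𝓝[<] (1 : ℝ)) := by
  intro x hx U hU
  filter_upwards [Ioo_mem_nhdsLT h1] with θ' hθ'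
  exact ⟨x, hS h0 hθ'.1 hθ'.2 hx, mem_of_mem_nhds hU⟩

/-! ### Fubini along a subspace and its orthogonal complement -/

instance {n : ℕ} (E : Submodule ℝ (Space n)) : (subspaceVolume E).IsAddHaarMeasure := by
  unfold subspaceVolume; infer_instance

theorem measurePreserving_of_withLp_prod {U V W : Type*}
    [NormedAddCommGroup U] [InnerProductSpace ℝ U] [MeasurableSpace U] [BorelSpace U]
    [FiniteDimensional ℝ U]
    [NormedAddCommGroup V] [InnerProductSpace ℝ V] [MeasurableSpace V] [BorelSpace V]
    [FiniteDimensional ℝ V]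
    [NormedAddCommGroup W] [InnerProductSpace ℝ W] [MeasurableSpace W] [BorelSpace W]
    [FiniteDimensional ℝ W] (e : WithLp 2 (U × V) ≃ₗᵢ[ℝ] W) :
    MeasurePreserving (fun p : U × V => e (WithLp.toLp 2 p))
      ((stdOrthonormalBasis ℝ U).toBasis.addHaar.prod (stdOrthonormalBasis ℝ V).toBasis.addHaar)
      volume := by
  rw [(stdOrthonormalBasis ℝ U).addHaar_eq_volume, (stdOrthonormalBasis ℝ V).addHaar_eq_volume]
  exact e.measurePreserving.comp (WithLp.volume_preserving_toLp U V)

theorem measurePreserving_coe_add_coe {n : ℕ} (E : Submodule ℝ (Space n)) :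
    MeasurePreserving (fun p : E × Eᗮ => (p.1 : Space n) + p.2)
      ((subspaceVolume E).prod (subspaceVolume Eᗮ)) volume := by
  convert measurePreserving_of_withLp_prod E.orthogonalDecomposition.symm using 2
  · simp
  · rfl
  · rfl

/-- Fubini's theorem along a subspace and its orthogonal complement. -/
theorem lintegral_eq_lintegral_orthogonal {n : ℕ} (E : Submodule ℝ (Space n))
    {f : Space n → ℝ≥0∞} (hf : Measurable f) :
    ∫⁻ z, f z = ∫⁻ y : Eᗮ, ∫⁻ e : E, f (e + y) ∂subspaceVolume E ∂subspaceVolume Eᗮ := by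
  rw [← (measurePreserving_coe_add_coe E).lintegral_comp hf, lintegral_prod_symm]
  exact (hf.comp (measurePreserving_coe_add_coe E).measurable).aemeasurable

theorem sectionVolume_eq_lintegral {n : ℕ} (E : Submodule ℝ (Space n)) {A : Set (Space n)}
    (hA : MeasurableSet A) (y : Space n) :
    sectionVolume E A y = ∫⁻ e : E, A.indicator 1 (e + y) ∂subspaceVolume E := by
  have hm : Measurable fun e : E => y + (e : Space n) := by fun_prop
  have h := lintegral_indicator_one (μ := subspaceVolume E) (hm hA)
  refine h.symm.trans ?_
  refine lintegral_congr fun e => ?_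
  rw [add_comm (e : Space n)]
  rfl

theorem measurable_sectionVolume {n : ℕ} (E : Submodule ℝ (Space n)) {A : Set (Space n)}
    (hA : MeasurableSet A) : Measurable fun y : Eᗮ => sectionVolume E A y := by
  simp only [sectionVolume_eq_lintegral E hA]
  exact ((measurable_one.indicator hA).comp
    (by fun_prop : Measurable fun p : Eᗮ × E => (p.2 : Space n) + p.1)).lintegral_prod_right'

theorem volume_eq_lintegral_sectionVolume {n : ℕ} (E : Submodule ℝ (Space n))
    {A : Set (Space n)} (hA : MeasurableSet A) :
    volume A = ∫⁻ y : Eᗮ, sectionVolume E A y ∂subspaceVolume Eᗮ := by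
  rw [← lintegral_indicator_one hA,
    lintegral_eq_lintegral_orthogonal E (measurable_one.indicator hA)]
  exact lintegral_congr fun y => (sectionVolume_eq_lintegral E hA y).symm

theorem volume_overlap_eq_lintegral {n : ℕ} {K L : Set (Space n)} (hK : MeasurableSet K)
    (hL : MeasurableSet L) (x : Space n) :
    volume (K ∩ ({x} - L)) =
      ∫⁻ z, K.indicator (1 : Space n → ℝ≥0∞) z * L.indicator 1 (x - z) := by
  have hset : K ∩ ({x} - L) = K ∩ (fun z => x - z) ⁻¹' L := by
    ext z; simp only [Set.mem_inter_iff, mem_singleton_sub, Set.mem_preimage]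
  have hm : Measurable fun z : Space n => x - z := by fun_prop
  rw [hset, ← lintegral_indicator_one (hK.inter (hm hL)), Set.inter_indicator_one]
  rfl

theorem measurable_overlap_integrand {n : ℕ} (E : Submodule ℝ (Space n)) {K L : Set (Space n)}
    (hK : MeasurableSet K) (hL : MeasurableSet L) : Measurable fun p : E × Space n =>
      K.indicator (1 : Space n → ℝ≥0∞) p.2 * L.indicator 1 ((p.1 : Space n) - p.2) :=
  ((measurable_one.indicator hK).comp measurable_snd).mul
    ((measurable_one.indicator hL).comp (by fun_prop))

theorem measurable_volume_overlap {n : ℕ} (E : Submodule ℝ (Space n)) {K L : Set (Space n)}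
    (hK : MeasurableSet K) (hL : MeasurableSet L) :
    Measurable fun e : E => volume (K ∩ ({(e : Space n)} - L)) := by
  simp only [volume_overlap_eq_lintegral hK hL]
  exact (measurable_overlap_integrand E hK hL).lintegral_prod_right'

/-- The integral over `E` of the overlap function. -/
theorem lintegral_volume_overlap {n : ℕ} (E : Submodule ℝ (Space n)) {K L : Set (Space n)}
    (hK : MeasurableSet K) (hL : MeasurableSet L) :
    ∫⁻ e : E, volume (K ∩ ({(e : Space n)} - L)) ∂subspaceVolume E =
      ∫⁻ y : Eᗮ, sectionVolume E K y * sectionVolume E (-L) y ∂subspaceVolume Eᗮ := by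
  have hKi : Measurable (K.indicator (1 : Space n → ℝ≥0∞)) := measurable_one.indicator hK
  have hLi : Measurable (L.indicator (1 : Space n → ℝ≥0∞)) := measurable_one.indicator hL
  have hψ : Measurable fun z : Space n =>
      ∫⁻ e : E, L.indicator (1 : Space n → ℝ≥0∞) (e - z) ∂subspaceVolume E :=
    (hLi.comp (by fun_prop : Measurable fun p : Space n × E =>
      (p.2 : Space n) - p.1)).lintegral_prod_right'
  simp only [volume_overlap_eq_lintegral hK hL]
  rw [lintegral_lintegral_swap (measurable_overlap_integrand E hK hL).aemeasurable]
  have h1 : ∀ z : Space n, ∫⁻ e : E, K.indicator (1 : Space n → ℝ≥0∞) z *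
      L.indicator 1 ((e : Space n) - z) ∂subspaceVolume E = K.indicator (1 : Space n → ℝ≥0∞) z *
      ∫⁻ e : E, L.indicator 1 ((e : Space n) - z) ∂subspaceVolume E := fun z =>
    lintegral_const_mul _ (hLi.comp (by fun_prop))
  simp only [h1]
  refine (lintegral_eq_lintegral_orthogonal E (hKi.mul hψ)).trans ?_
  refine lintegral_congr fun y => ?_
  -- By translation and reflection invariance on E, the inner integral depends only on the component
  -- y orthogonal to E.
  have h2 : ∀ e' : E, ∫⁻ e : E, L.indicator (1 : Space n → ℝ≥0∞)
      (e - (e' + y)) ∂subspaceVolume E = sectionVolume E (-L) y := by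
    intro e'
    rw [sectionVolume_eq_lintegral E hL.neg]
    refine (lintegral_sub_left_eq_self _ e').symm.trans (lintegral_congr fun e => ?_)
    have h3 : ((e' - e : E) : Space n) - (e' + y) = -(e + y) := by
      push_cast
      abel
    rw [h3]
    rfl
  simp only [Pi.mul_apply, h2]
  rw [sectionVolume_eq_lintegral E hK]
  exact lintegral_mul_const _ (hKi.comp (by fun_prop))

/-! ### The Beta integral -/

/-- Integration by parts trades a factor 1 - u for a factor u, so the induction on k must let n
vary. -/
theorem integral_one_sub_pow_mul_pow (n k : ℕ) :
    (∫ u in (0 : ℝ)..1, (1 - u) ^ k * ((n + 1 : ℕ) * u ^ n)) * ((n + 1 + k).choose (n + 1) : ℝ) =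
      1 := by
  induction k generalizing n with
  | zero =>
    simp [integral_pow]
    field_simp
  | succ k ih =>
    have hparts := intervalIntegral.integral_mul_deriv_eq_deriv_mul (a := 0) (b := 1)
      (u := fun u : ℝ => (1 - u) ^ (k + 1)) (u' := fun u => -((k + 1 : ℕ) * (1 - u) ^ k))
      (v := fun u => u ^ (n + 1)) (v' := fun u => (n + 1 : ℕ) * u ^ n)
      (fun u _ => by
        have := ((hasDerivAt_id u).const_sub 1).fun_pow (k + 1)
        simpa using this) (fun u _ => by simpa using hasDerivAt_pow (n + 1) u)
      (by apply Continuous.intervalIntegrable; fun_prop)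
      (by apply Continuous.intervalIntegrable; fun_prop)
    have hrw : ∫ u in (0 : ℝ)..1, (-((k + 1 : ℕ) * (1 - u) ^ k)) * u ^ (n + 1) =
        -(((k + 1 : ℕ) : ℝ) / (n + 2 : ℕ)) *
          ∫ u in (0 : ℝ)..1, (1 - u) ^ k * ((n + 1 + 1 : ℕ) * u ^ (n + 1)) := by
      rw [← intervalIntegral.integral_const_mul]
      refine intervalIntegral.integral_congr fun u _ => ?_
      push_cast
      field_simp
      ring
    have hch : (((n + 1 + (k + 1)).choose (n + 1) : ℕ) : ℝ) * (k + 1 : ℕ) =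
        ((n + 1 + 1 + k).choose (n + 1 + 1) : ℕ) * (n + 2 : ℕ) := by
      have := Nat.choose_succ_right_eq (n + 1 + (k + 1)) (n + 1)
      rw [Nat.add_sub_cancel_left] at this
      rw [show n + 1 + 1 + k = n + 1 + (k + 1) by ring]
      exact_mod_cast this.symm
    rw [hparts, hrw]
    have := ih (n + 1)
    set J := ∫ u in (0 : ℝ)..1, (1 - u) ^ k * ((n + 1 + 1 : ℕ) * u ^ (n + 1))
    have hn2 : ((n + 2 : ℕ) : ℝ) ≠ 0 := by positivity
    calc _ = J * ((((n + 1 + (k + 1)).choose (n + 1) : ℕ) : ℝ) * (k + 1 : ℕ)) / (n + 2 : ℕ) := by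
          simp; ring
      _ = J * (((n + 1 + 1 + k).choose (n + 1 + 1) : ℕ)) := by
          rw [hch]; field_simp
      _ = 1 := this

/-- The substitution θ = u^n reduces this to the Beta integral. -/
theorem lintegral_one_sub_rpow_pow {n : ℕ} (hn : n ≠ 0) (k : ℕ) :
    ∫⁻ θ in Set.Ioo (0 : ℝ) 1, ENNReal.ofReal ((1 - θ ^ (1 / (n : ℝ))) ^ k) =
      ((n + k).choose n : ℝ≥0∞)⁻¹ := by
  have hcont : Continuous fun θ : ℝ => (1 - θ ^ (1 / (n : ℝ))) ^ k :=
    (continuous_const.sub (Real.continuous_rpow_const (by positivity))).pow k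
  have hpos : ∀ θ ∈ Set.Ioo (0 : ℝ) 1, 0 ≤ (1 - θ ^ (1 / (n : ℝ))) ^ k := fun θ hθ =>
    pow_nonneg (sub_nonneg.2 (rpow_one_div_lt_one hn hθ.1 hθ.2).le) k
  have hint : IntegrableOn (fun θ : ℝ => (1 - θ ^ (1 / (n : ℝ))) ^ k) (Set.Ioo 0 1) :=
    (hcont.integrableOn_Icc (a := 0) (b := 1)).mono_set Set.Ioo_subset_Icc_self
  rw [← ofReal_integral_eq_lintegral_ofReal hint
    ((ae_restrict_iff' measurableSet_Ioo).2 (ae_of_all _ hpos)), ← integral_Ioc_eq_integral_Ioo,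
    ← intervalIntegral.integral_of_le zero_le_one]
  obtain ⟨m, rfl⟩ := Nat.exists_eq_succ_of_ne_zero hn
  have hsub := intervalIntegral.integral_comp_mul_deriv (a := 0) (b := 1)
    (f := fun u : ℝ => u ^ (m + 1)) (f' := fun u => (m + 1 : ℕ) * u ^ m)
    (g := fun θ : ℝ => (1 - θ ^ (1 / ((m + 1 : ℕ) : ℝ))) ^ k)
    (fun u _ => by simpa using hasDerivAt_pow (m + 1) u) (by fun_prop) hcont
  simp only [Function.comp_def, one_pow, zero_pow (Nat.succ_ne_zero m)] at hsub
  have hJ : ∫ u in (0 : ℝ)..1, (1 - (u ^ (m + 1)) ^ (1 / ((m + 1 : ℕ) : ℝ))) ^ k *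
      ((m + 1 : ℕ) * u ^ m) = ∫ u in (0 : ℝ)..1, (1 - u) ^ k * ((m + 1 : ℕ) * u ^ m) := by
    refine intervalIntegral.integral_congr fun u hu => ?_
    rw [Set.uIcc_of_le zero_le_one] at hu
    simp only [one_div, Real.pow_rpow_inv_natCast hu.1 (Nat.succ_ne_zero m)]
  have hB := integral_one_sub_pow_mul_pow m k
  have hc : (0 : ℝ) < ((m + 1 + k).choose (m + 1) : ℕ) := by
    exact_mod_cast Nat.choose_pos (by lia)
  rw [hJ] at hsub
  rw [Nat.succ_eq_add_one, ← hsub, eq_inv_of_mul_eq_one_left hB, ENNReal.ofReal_inv_of_pos hc,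
    ENNReal.ofReal_natCast]

theorem subspaceVolume_smul {n : ℕ} (E : Submodule ℝ (Space n)) {r : ℝ} (hr : 0 ≤ r)
    (A : Set E) : subspaceVolume E (r • A) =
      ENNReal.ofReal (r ^ Module.finrank ℝ E) * subspaceVolume E A := by
  rw [Measure.addHaar_smul, abs_of_nonneg (pow_nonneg hr _)]

/-! ### The section inequality -/

/-- The volume of sections of a set containing all rescaled convolution bodies. -/
theorem choose_mul_lintegral_le {n : ℕ} (hn : n ≠ 0) (E : Submodule ℝ (Space n))
    {K L : Set (Space n)} (hK : IsCompact K) (hL : IsCompact L) (hM0 : maxOverlap K L ≠ 0)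
    {C : Set (Space n)}
    (hC : ∀ θ : ℝ, 0 < θ → θ < 1 → scaledConvolutionBody K L θ ⊆ C) :
    ((n + Module.finrank ℝ E).choose n : ℝ≥0∞) *
      ∫⁻ y : Eᗮ, sectionVolume E K y * sectionVolume E (-L) y / maxOverlap K L
        ∂subspaceVolume Eᗮ ≤ sectionVolume E C 0 := by
  set k := Module.finrank ℝ E with hk
  have hMt : maxOverlap K L ≠ ∞ := maxOverlap_ne_top hK L
  have hmeas := measurable_volume_overlap E hK.measurableSet hL.measurableSet
  have hle : ∫⁻ y : Eᗮ, sectionVolume E K y * sectionVolume E (-L) y / maxOverlap K L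
        ∂subspaceVolume Eᗮ ≤ ((n + k).choose n : ℝ≥0∞)⁻¹ * sectionVolume E C 0 := by
    calc _ = ∫⁻ e : E, volume (K ∩ ({(e : Space n)} - L)) / maxOverlap K L ∂subspaceVolume E := by
          simp only [div_eq_mul_inv]
          rw [lintegral_mul_const' _ _ (ENNReal.inv_ne_top.2 hM0),
            lintegral_mul_const' _ _ (ENNReal.inv_ne_top.2 hM0),
            lintegral_volume_overlap E hK.measurableSet hL.measurableSet]
      _ = ∫⁻ θ in Set.Ioo (0 : ℝ) 1, subspaceVolume E
            {e : E | ENNReal.ofReal θ < volume (K ∩ ({(e : Space n)} - L)) / maxOverlap K L} := by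
          refine lintegral_eq_lintegral_Ioo_meas_lt _ (hmeas.div_const _) fun e => ?_
          exact ENNReal.div_le_of_le_mul (by
            rw [one_mul]; exact le_iSup (fun z => volume (K ∩ ({z} - L))) (e : Space n))
      _ ≤ ∫⁻ θ in Set.Ioo (0 : ℝ) 1,
            ENNReal.ofReal ((1 - θ ^ (1 / (n : ℝ))) ^ k) * sectionVolume E C 0 := by
          refine setLIntegral_mono' measurableSet_Ioo fun θ hθ => ?_
          have hr : 0 < 1 - θ ^ (1 / (n : ℝ)) := sub_pos.2 (rpow_one_div_lt_one hn hθ.1 hθ.2)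
          rw [sectionVolume, ← subspaceVolume_smul E hr.le]
          -- A point of E with f > θ lies in the convolution body, hence in (1 - θ^(1/n)) C.
          refine measure_mono fun e he => ?_
          have he' : (e : Space n) ∈ convolutionBody K L θ := by
            rw [mem_convolutionBody_iff hM0 hθ.1]
            exact ((ENNReal.lt_div_iff_mul_lt (Or.inl hM0) (Or.inl hMt)).1 he).le
          rw [Set.mem_smul_set_iff_inv_smul_mem₀ hr.ne']
          simpa using hC θ hθ.1 hθ.2 (Set.smul_mem_smul_set he')
      _ = _ := by
          rw [lintegral_mul_const, lintegral_one_sub_rpow_pow hn]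
          refine ENNReal.measurable_ofReal.comp (Continuous.measurable ?_)
          exact (continuous_const.sub (Real.continuous_rpow_const (by positivity))).pow k
  refine (mul_le_mul_right hle _).trans_eq ?_
  rw [← mul_assoc, ENNReal.mul_inv_cancel, one_mul]
  · exact_mod_cast (Nat.choose_pos (by lia)).ne'
  · exact ENNReal.natCast_ne_top _

/-! ### Differences of a body and its translates -/

/-- The points of `K` that are not in `u + K`. -/
def translateDiff {n : ℕ} (K : Set (Space n)) (u : Space n) : Set (Space n) :=
  {z | z ∈ K ∧ z - u ∉ K}

theorem measurableSet_translateDiff {n : ℕ} {K : Set (Space n)} (hK : MeasurableSet K)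
    (u : Space n) : MeasurableSet (translateDiff K u) :=
  hK.inter ((by fun_prop : Measurable fun z : Space n => z - u) hK).compl

/-- If z ∈ K but z - u - v ∉ K, then K is left either in the step from z to z - u or in the step
from z - u to z - u - v. -/
theorem volume_translateDiff_add_le {n : ℕ} {K : Set (Space n)} (u v : Space n) :
    volume (translateDiff K (u + v)) ≤
      volume (translateDiff K u) + volume (translateDiff K v) := by
  have hsub : translateDiff K (u + v) ⊆
      translateDiff K u ∪ (fun z => z + -u) ⁻¹' translateDiff K v := by
    rintro z ⟨hz, hz'⟩
    by_cases h : z - u ∈ K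
    · refine Or.inr ⟨by simpa [sub_eq_add_neg] using h, ?_⟩
      rwa [show z + -u - v = z - (u + v) by abel]
    · exact Or.inl ⟨hz, h⟩
  refine (measure_mono hsub).trans ((measure_union_le _ _).trans_eq ?_)
  rw [measure_preimage_add_right]

theorem volume_translateDiff_nsmul_le {n : ℕ} {K : Set (Space n)} (u : Space n) (N : ℕ) :
    volume (translateDiff K ((N : ℝ) • u)) ≤ N * volume (translateDiff K u) := by
  induction N with
  | zero =>
    have : translateDiff K ((0 : ℝ) • u) = ∅ := by
      ext z; simp [translateDiff]
    rw [Nat.cast_zero, this]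
    simp
  | succ N ih =>
    rw [Nat.cast_succ, add_smul, one_smul, Nat.cast_succ, add_mul, one_mul]
    exact (volume_translateDiff_add_le _ _).trans (by gcongr)

theorem volume_overlap_add_volume_translateDiff {n : ℕ} {K : Set (Space n)}
    (hK : MeasurableSet K) (u : Space n) :
    volume (K ∩ ({u} - -K)) + volume (translateDiff K u) = volume K := by
  have h1 : translateDiff K u = K \ ({u} - -K) := by
    ext z
    simp only [translateDiff, Set.mem_ofPred_eq, Set.mem_sdiff, mem_singleton_sub, Set.mem_neg,
      neg_sub]
  have h2 : MeasurableSet ({u} - -K) := by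
    have : ({u} - -K : Set (Space n)) = (fun z => z - u) ⁻¹' K := by
      ext z; simp only [mem_singleton_sub, Set.mem_neg, neg_sub, Set.mem_preimage]
    rw [this]
    exact (by fun_prop : Measurable fun z : Space n => z - u) hK
  rw [h1, measure_inter_add_sdiff _ h2]

/-- The directions in which the volume of `K` outside its translates grows at most at rate `c`. -/
def slowDirections {n : ℕ} (K : Set (Space n)) (c : ℝ≥0∞) : Set (Space n) :=
  {x | ∀ s : ℝ, 0 < s → volume (translateDiff K (s • x)) ≤ ENNReal.ofReal s * c}

theorem maxOverlap_neg {n : ℕ} (K : Set (Space n)) : maxOverlap K (-K) = volume K := by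
  refine le_antisymm (iSup_le fun _ => measure_mono Set.inter_subset_left) ?_
  refine le_trans (measure_mono ?_) (le_iSup (fun z => volume (K ∩ ({z} - -K))) 0)
  exact fun z hz => ⟨hz, mem_singleton_sub.2 (by simpa using hz)⟩

/-- Monotonicity in θ gives the rate for small steps rx; subadditivity over N such steps extends it
to every s = Nr. -/
theorem scaledConvolutionBody_subset_slowDirections {n : ℕ} (hn : n ≠ 0) {K : Set (Space n)}
    (hK : IsCompact K) (hKc : Convex ℝ K) (hK0 : volume K ≠ 0) {θ : ℝ} (h0 : 0 < θ)
    (h1 : θ < 1) :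
    scaledConvolutionBody K (-K) θ ⊆ slowDirections K (n * volume K) := by
  intro x hx s hs
  have hKt := hK.measure_ne_top (μ := volume)
  set r₀ := 1 - θ ^ (1 / (n : ℝ)) with hr₀
  have hr₀0 : 0 < r₀ := sub_pos.2 (rpow_one_div_lt_one hn h0 h1)
  obtain ⟨N, hN⟩ := exists_nat_gt (max (s / r₀) s)
  have hN0 : (0 : ℝ) < N := hs.trans (lt_of_le_of_lt (le_max_right _ _) hN)
  set r := s / N with hr
  have hr0 : 0 < r := div_pos hs hN0
  have hr1 : r < 1 := (div_lt_one hN0).2 (lt_of_le_of_lt (le_max_right _ _) hN)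
  have hrr : r < r₀ := by
    rw [hr, div_lt_iff₀ hN0, ← div_lt_iff₀' hr₀0]
    exact lt_of_le_of_lt (le_max_left _ _) hN
  -- This level has 1 - θ'^(1/n) = r, so rx itself lies in the convolution body of level θ'.
  set θ' := (1 - r) ^ n with hθ'
  have hθr : θ' ^ (1 / (n : ℝ)) = 1 - r := by
    rw [one_div, hθ', Real.pow_rpow_inv_natCast (by linarith) hn]
  have hθθ' : θ < θ' := by
    rw [← rpow_one_div_pow hn h0]
    exact pow_lt_pow_left₀ (by linarith) (by positivity) hn
  have hθ'1 : θ' < 1 := pow_lt_one₀ (by linarith) (by linarith) hn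
  obtain ⟨w, hw, hwx⟩ := scaledConvolutionBody_mono hn hK hK.neg hKc hKc.neg
    (by rwa [maxOverlap_neg]) (by rw [neg_neg, Set.inter_self, maxOverlap_neg])
    h0 hθθ' hθ'1 hx
  have hwr : w = r • x := by
    rw [← hwx]
    simp only [hθr, sub_sub_cancel, smul_smul, mul_inv_cancel₀ hr0.ne', one_smul]
  have hvol : volume (translateDiff K (r • x)) ≤ ENNReal.ofReal r * (n * volume K) := by
    have h2 := hw.2
    rw [maxOverlap_neg, hwr] at h2
    have h3 := volume_overlap_add_volume_translateDiff hK.measurableSet (r • x)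
    have h4 : ENNReal.ofReal θ' * volume K + ENNReal.ofReal r * (n * volume K) ≥ volume K := by
      rw [← mul_assoc, ← add_mul, ← ENNReal.ofReal_natCast n, ← ENNReal.ofReal_mul hr0.le,
        ← ENNReal.ofReal_add (by positivity) (by positivity)]
      refine le_mul_of_one_le_left' ?_
      rw [ENNReal.one_le_ofReal]
      -- Bernoulli: 1 - nr ≤ (1 - r)^n = θ'.
      have := one_add_mul_le_pow (show (-2 : ℝ) ≤ -r by linarith) n
      rw [← sub_eq_add_neg] at this
      linarith
    have h5 : volume (K ∩ ({r • x} - -K)) + volume (translateDiff K (r • x)) ≤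
        volume (K ∩ ({r • x} - -K)) + ENNReal.ofReal r * (n * volume K) := by
      rw [h3]
      exact h4.le.trans (by gcongr)
    refine (ENNReal.add_le_add_iff_left ?_).1 h5
    exact ne_top_of_le_ne_top hKt (measure_mono Set.inter_subset_left)
  have hsN : s • x = (N : ℝ) • (r • x) := by
    rw [smul_smul, hr, mul_div_cancel₀ _ hN0.ne']
  calc volume (translateDiff K (s • x)) ≤ N * volume (translateDiff K (r • x)) := by
        rw [hsN]; exact volume_translateDiff_nsmul_le _ _
    _ ≤ N * (ENNReal.ofReal r * (n * volume K)) := by gcongr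
    _ = ENNReal.ofReal s * (n * volume K) := by
        rw [← mul_assoc, ← ENNReal.ofReal_natCast N, ← ENNReal.ofReal_mul hN0.le, hr,
          mul_div_cancel₀ _ hN0.ne']

/-! ### Shadows along a line -/

theorem subspaceVolume_span_singleton {n : ℕ} {u : Space n} (hu : ‖u‖ = 1) {a b : ℝ} :
    subspaceVolume (Submodule.span ℝ {u}) {e | ∃ t ∈ Set.Ico a b, (e : Space n) = t • u} =
      ENNReal.ofReal (b - a) := by
  have hmp := (LinearIsometryEquiv.toSpanUnitSingleton (𝕜 := ℝ) u hu).measurePreserving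
  have hu0 : u ≠ 0 := norm_ne_zero_iff.1 (hu ▸ one_ne_zero)
  rw [subspaceVolume, OrthonormalBasis.addHaar_eq_volume, ← Real.volume_Ico]
  refine (MeasurePreserving.measure_preimage_equiv
    (f := (LinearIsometryEquiv.toSpanUnitSingleton (𝕜 := ℝ) u hu).toMeasurableEquiv)
    hmp _).symm.trans ?_
  congr 1
  ext t
  constructor
  · rintro ⟨t', ht', h⟩
    rwa [show t = t' from smul_left_injective ℝ hu0 h]
  · exact fun ht => ⟨t, ht, rfl⟩

/-- The line y + ℝu meets K in an interval with lowest parameter t₀. Shifting K by su uncovers [t₀,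
t₀ + s), which stays inside the interval while t₀ + s is below the parameter t₁ of z. -/
theorem le_sectionVolume_translateDiff {n : ℕ} {K : Set (Space n)} (hK : IsCompact K)
    (hKc : Convex ℝ K) {u : Space n} (hu : ‖u‖ = 1) {y z : Space n}
    (hz : z ∈ interior K) (hzy : z - y ∈ Submodule.span ℝ {u}) :
    ∃ δ > 0, ∀ s : ℝ, 0 < s → s < δ → ENNReal.ofReal s ≤
      sectionVolume (Submodule.span ℝ {u}) (translateDiff K (s • u)) y := by
  obtain ⟨t₁, ht₁⟩ := Submodule.mem_span_singleton.1 hzy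
  have hline : Continuous fun t : ℝ => y + t • u := by fun_prop
  set I : Set ℝ := {t | y + t • u ∈ K} with hI
  have hIc : IsClosed I := hK.isClosed.preimage hline
  have hIb : BddBelow I := by
    obtain ⟨R, hR⟩ := hK.isBounded.subset_closedBall 0
    refine ⟨-(R + ‖y‖), fun t ht => ?_⟩
    have h1 : ‖y + t • u‖ ≤ R := by simpa using hR ht
    have h2 : ‖t • u‖ ≤ ‖y + t • u‖ + ‖y‖ := by
      simpa using norm_sub_le (y + t • u) y
    rw [norm_smul, hu, mul_one, Real.norm_eq_abs] at h2
    linarith [neg_abs_le t]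
  have ht₁I : I ∈ 𝓝 t₁ := by
    have : y + t₁ • u = z := by rw [ht₁]; abel
    exact hline.continuousAt.preimage_mem_nhds (by rw [this]; exact mem_interior_iff_mem_nhds.1 hz)
  have hne : I.Nonempty := ⟨t₁, mem_of_mem_nhds ht₁I⟩
  have ht₀ : sInf I ∈ I := hIc.csInf_mem hne hIb
  set t₀ := sInf I with ht₀def
  have hlt : t₀ < t₁ := by
    obtain ⟨t, ht, htI⟩ := ((frequently_lt_nhds t₁).and_eventually ht₁I).exists
    exact (csInf_le hIb htI).trans_lt ht
  have hIconv : Convex ℝ I := by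
    intro a ha b hb p q hp hq hpq
    have := hKc ha hb hp hq hpq
    have he : p • (y + a • u) + q • (y + b • u) = y + (p • a + q • b) • u := by
      calc _ = (p + q) • y + (p • a + q • b) • u := by
            simp only [smul_add, add_smul, smul_smul, smul_eq_mul]; abel
        _ = _ := by rw [hpq, one_smul]
    rwa [he] at this
  refine ⟨t₁ - t₀, sub_pos.2 hlt, fun s hs hsδ => ?_⟩
  have hvol := subspaceVolume_span_singleton hu (a := t₀) (b := t₀ + s)
  rw [add_sub_cancel_left] at hvol
  rw [← hvol]
  refine measure_mono ?_
  rintro e ⟨t, ht, he⟩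
  have htI : t ∈ I := hIconv.ordConnected.out ht₀ (mem_of_mem_nhds ht₁I)
    ⟨ht.1, by linarith [ht.2]⟩
  refine ⟨by rw [he]; exact htI, fun hmem => ?_⟩
  have : t - s ∈ I := by
    rw [he, add_sub_assoc, ← sub_smul] at hmem
    exact hmem
  have := csInf_le hIb this
  linarith [ht.2]

/-- The projection of K lies in the closure of the projected interior, an open convex set, and the
frontier of a convex set is null. -/
theorem projectionVolume_le_interior {n : ℕ} (E : Submodule ℝ (Space n)) {K : Set (Space n)}
    (hKc : Convex ℝ K) (hKi : (interior K).Nonempty) :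
    projectionVolume E K ≤ subspaceVolume E (E.orthogonalProjectionOnto '' interior K) := by
  set P := E.orthogonalProjectionOnto
  set U := P '' interior K with hU
  have hUo : IsOpen U := by
    refine P.isOpenMap ?_ _ isOpen_interior
    exact fun e => ⟨e, Submodule.orthogonalProjectionOnto_mem_subspace_eq_self e⟩
  have hUc : Convex ℝ U := hKc.interior.linear_image P.toLinearMap
  have hsub : P '' K ⊆ closure U := by
    refine Set.Subset.trans ?_ (image_closure_subset_closure_image P.continuous)
    refine Set.image_mono ?_
    rw [hKc.closure_interior_eq_closure_of_nonempty_interior hKi]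
    exact subset_closure
  calc subspaceVolume E (P '' K) ≤ subspaceVolume E (U ∪ frontier U) := by
        refine measure_mono (hsub.trans ?_)
        rw [closure_eq_self_union_frontier]
    _ ≤ subspaceVolume E U + subspaceVolume E (frontier U) := measure_union_le _ _
    _ = subspaceVolume E U := by rw [hUc.addHaar_frontier (subspaceVolume E), add_zero]

/-- By Fubini, |K \ (su + K)| / s is the integral over u^⊥ of section lengths divided by s. Their
liminf as s → 0 is at least one over the projected interior, so Fatou's lemma applies. -/
theorem projectionVolume_span_singleton_orthogonal_le {n : ℕ} {K : Set (Space n)}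
    (hK : IsCompact K) (hKc : Convex ℝ K) (hKi : (interior K).Nonempty) {u : Space n}
    (hu : ‖u‖ = 1) {c : ℝ≥0∞} (h : u ∈ slowDirections K c) :
    projectionVolume (Submodule.span ℝ {u})ᗮ K ≤ c := by
  set V := Submodule.span ℝ {u} with hV
  refine (projectionVolume_le_interior Vᗮ hKc hKi).trans ?_
  set U := Vᗮ.orthogonalProjectionOnto '' interior K with hU
  have hUo : IsOpen U := by
    refine Vᗮ.orthogonalProjectionOnto.isOpenMap ?_ _ isOpen_interior
    exact fun e => ⟨e, Submodule.orthogonalProjectionOnto_mem_subspace_eq_self e⟩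
  have hD := fun s : ℝ => measurableSet_translateDiff hK.measurableSet (s • u)
  set s : ℕ → ℝ := fun j => 1 / ((j : ℝ) + 1) with hs
  have hs0 : ∀ j, 0 < s j := fun j => Nat.one_div_pos_of_nat
  have hslim : Tendsto s atTop (𝓝 0) := tendsto_one_div_add_atTop_nhds_zero_nat
  rw [← lintegral_indicator_one hUo.measurableSet]
  calc ∫⁻ y, U.indicator 1 y ∂subspaceVolume Vᗮ
      ≤ ∫⁻ y : Vᗮ, liminf (fun j => (ENNReal.ofReal (s j))⁻¹ *
          sectionVolume V (translateDiff K (s j • u)) y) atTop ∂subspaceVolume Vᗮ := by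
        refine lintegral_mono fun y => ?_
        by_cases hy : y ∈ U
        · obtain ⟨z, hz, hzy⟩ := hy
          have hmem : z - y ∈ V := by
            have h1 := Submodule.sub_starProjection_mem_orthogonal (K := Vᗮ) z
            rw [Submodule.orthogonal_orthogonal] at h1
            rw [← hzy]
            exact h1
          obtain ⟨δ, hδ, hδs⟩ := le_sectionVolume_translateDiff hK hKc hu hz hmem
          rw [Set.indicator_of_mem (show y ∈ U from ⟨z, hz, hzy⟩)]
          refine le_liminf_of_le (by isBoundedDefault) ?_
          filter_upwards [hslim.eventually (gt_mem_nhds hδ)] with j hj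
          calc (1 : ℝ≥0∞) = (ENNReal.ofReal (s j))⁻¹ * ENNReal.ofReal (s j) :=
                (ENNReal.inv_mul_cancel (by simpa using hs0 j) ENNReal.ofReal_ne_top).symm
            _ ≤ _ := by gcongr; exact hδs _ (hs0 j) hj
        · simp [hy]
    _ ≤ liminf (fun j => ∫⁻ y : Vᗮ, (ENNReal.ofReal (s j))⁻¹ *
          sectionVolume V (translateDiff K (s j • u)) y ∂subspaceVolume Vᗮ) atTop :=
        lintegral_liminf_le fun j => (measurable_sectionVolume V (hD _)).const_mul _
    _ ≤ c := by
        refine liminf_le_of_le (by isBoundedDefault) fun b hb => ?_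
        obtain ⟨j, hj⟩ := hb.exists
        refine hj.trans ?_
        rw [lintegral_const_mul _ (measurable_sectionVolume V (hD _)),
          ← volume_eq_lintegral_sectionVolume V (hD _)]
        calc _ ≤ (ENNReal.ofReal (s j))⁻¹ * (ENNReal.ofReal (s j) * c) := by
              gcongr; exact h _ (hs0 j)
          _ = c := by
              rw [← mul_assoc, ENNReal.inv_mul_cancel (by simpa using hs0 j)
                ENNReal.ofReal_ne_top, one_mul]

theorem enorm_mul_projectionVolume_le {n : ℕ} {K : Set (Space n)} (hK : IsCompact K)
    (hKc : Convex ℝ K) (hKi : (interior K).Nonempty) {x : Space n} {c : ℝ≥0∞}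
    (h : x ∈ slowDirections K c) :
    ‖x‖ₑ * projectionVolume (Submodule.span ℝ {x})ᗮ K ≤ c := by
  by_cases hx : x = 0
  · simp [hx]
  have hx0 : 0 < ‖x‖ := norm_pos_iff.2 hx
  have hspan : Submodule.span ℝ {x} = Submodule.span ℝ {‖x‖⁻¹ • x} :=
    (Submodule.span_singleton_smul_eq (IsUnit.mk0 _ (inv_ne_zero hx0.ne')) x).symm
  have hu : ‖‖x‖⁻¹ • x‖ = 1 := by rw [norm_smul, norm_inv, norm_norm, inv_mul_cancel₀ hx0.ne']
  have hmem : ‖x‖⁻¹ • x ∈ slowDirections K (ENNReal.ofReal ‖x‖⁻¹ * c) := by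
    intro s hs
    rw [smul_smul, ← mul_assoc, ← ENNReal.ofReal_mul hs.le]
    exact h _ (by positivity)
  rw [hspan]
  calc _ ≤ ‖x‖ₑ * (ENNReal.ofReal ‖x‖⁻¹ * c) := by
        gcongr
        exact projectionVolume_span_singleton_orthogonal_le hK hKc hKi hu hmem
    _ = c := by
        rw [← ofReal_norm, ← mul_assoc, ← ENNReal.ofReal_mul hx0.le, mul_inv_cancel₀ hx0.ne',
          ENNReal.ofReal_one, one_mul]

theorem sectionVolume_le_polarProjectionBody {n : ℕ} (hn : n ≠ 0) (E : Submodule ℝ (Space n))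
    {K : Set (Space n)} (hK : IsCompact K) (hKc : Convex ℝ K) (hKi : (interior K).Nonempty) :
    sectionVolume E (slowDirections K (n * volume K)) 0 ≤
      (n : ℝ≥0∞) ^ Module.finrank ℝ E * volume K ^ Module.finrank ℝ E *
        sectionVolume E (polarProjectionBody K) 0 := by
  have hKt := hK.measure_ne_top (μ := volume)
  have hK0 : volume K ≠ 0 := (Measure.measure_pos_of_nonempty_interior _ hKi).ne'
  set c : ℝ := (n * volume K).toReal with hc
  have hct : (n * volume K : ℝ≥0∞) ≠ ∞ := ENNReal.mul_ne_top (ENNReal.natCast_ne_top n) hKt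
  have hc0 : 0 < c := ENNReal.toReal_pos (mul_ne_zero (by exact_mod_cast hn) hK0) hct
  have hce : ENNReal.ofReal c = n * volume K := ENNReal.ofReal_toReal hct
  rw [← mul_pow, ← hce, ← ENNReal.ofReal_pow hc0.le, sectionVolume, sectionVolume,
    ← subspaceVolume_smul E hc0.le]
  refine measure_mono fun e he => ?_
  rw [Set.mem_smul_set_iff_inv_smul_mem₀ hc0.ne']
  have he' : (e : Space n) ∈ slowDirections K (ENNReal.ofReal c) := by simpa using he
  -- The rate is homogeneous in the direction: scaling by 1/c turns rate c into rate 1.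
  have hmem : c⁻¹ • (e : Space n) ∈ slowDirections K 1 := by
    intro s hs
    have := he' (s * c⁻¹) (by positivity)
    rwa [← ENNReal.ofReal_mul (by positivity), mul_assoc, inv_mul_cancel₀ hc0.ne', mul_one,
      ← smul_smul, ← mul_one (ENNReal.ofReal s)] at this
  have := enorm_mul_projectionVolume_le hK hKc hKi hmem
  simpa [polarProjectionBody] using this

/-! ### Cauchy–Schwarz for sections, and the theorem -/

/-- The Cauchy–Schwarz inequality for the section function. -/
theorem volume_div_projectionVolume_le {n : ℕ} (E : Submodule ℝ (Space n)) {K : Set (Space n)}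
    (hK : IsCompact K) (hK0 : volume K ≠ 0) :
    volume K / projectionVolume Eᗮ K ≤
      ∫⁻ y : Eᗮ, sectionVolume E K y * sectionVolume E K y / volume K ∂subspaceVolume Eᗮ := by
  have hKt := hK.measure_ne_top (μ := volume)
  set P := Eᗮ.orthogonalProjectionOnto '' K with hP
  have hPm : MeasurableSet P := (hK.image (by fun_prop)).measurableSet
  have hm := measurable_sectionVolume E hK.measurableSet
  have hsupp : ∀ y : Eᗮ, y ∉ P → sectionVolume E K y = 0 := by
    intro y hy
    have : {e : E | (y : Space n) + e ∈ K} = ∅ := by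
      refine Set.eq_empty_of_forall_notMem fun e he => hy ⟨_, he, ?_⟩
      rw [map_add, Submodule.orthogonalProjectionOnto_mem_subspace_eq_self]
      simp
    rw [sectionVolume, this, measure_empty]
  have hPi : Measurable (P.indicator (1 : Eᗮ → ℝ≥0∞)) := measurable_one.indicator hPm
  -- The section function is paired with the indicator of the projection, outside which it vanishes.
  have hcs := ENNReal.lintegral_mul_le_Lp_mul_Lq (subspaceVolume Eᗮ)
    (Real.holderConjugate_iff.2 ⟨one_lt_two, by norm_num⟩ : (2 : ℝ).HolderConjugate 2)
    hm.aemeasurable hPi.aemeasurable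
  have h1 : ∫⁻ y : Eᗮ, ((fun y : Eᗮ => sectionVolume E K y) * P.indicator (1 : Eᗮ → ℝ≥0∞)) y
      ∂subspaceVolume Eᗮ = volume K := by
    rw [volume_eq_lintegral_sectionVolume E hK.measurableSet]
    refine lintegral_congr fun y => ?_
    by_cases hy : y ∈ P
    · simp [hy]
    · simp [hy, hsupp y hy]
  have h2 : ∫⁻ y : Eᗮ, P.indicator (1 : Eᗮ → ℝ≥0∞) y ^ (2 : ℝ) ∂subspaceVolume Eᗮ =
      projectionVolume Eᗮ K := by
    rw [projectionVolume, ← hP, ← lintegral_indicator_one hPm]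
    refine lintegral_congr fun y => ?_
    by_cases hy : y ∈ P <;> simp [hy]
  rw [h1, h2] at hcs
  set Q := ∫⁻ y : Eᗮ, sectionVolume E K y ^ (2 : ℝ) ∂subspaceVolume Eᗮ with hQ
  have hsq : volume K * volume K ≤ Q * projectionVolume Eᗮ K := by
    have := mul_le_mul' hcs hcs
    rwa [mul_mul_mul_comm, ← ENNReal.rpow_add_of_nonneg _ _ (by norm_num) (by norm_num),
      ← ENNReal.rpow_add_of_nonneg _ _ (by norm_num) (by norm_num), add_halves, ENNReal.rpow_one,
      ENNReal.rpow_one] at this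
  have hQ' : ∫⁻ y : Eᗮ, sectionVolume E K y * sectionVolume E K y / volume K ∂subspaceVolume Eᗮ =
      Q / volume K := by
    simp only [div_eq_mul_inv]
    rw [lintegral_mul_const' _ _ (ENNReal.inv_ne_top.2 hK0), hQ]
    simp only [ENNReal.rpow_two, sq]
  rw [hQ']
  refine ENNReal.div_le_of_le_mul ?_
  rw [ENNReal.div_eq_inv_mul, mul_assoc, ← ENNReal.div_eq_inv_mul,
    ENNReal.le_div_iff_mul_le (Or.inl hK0) (Or.inl hKt)]
  exact hsq

end ConvolutionBody

theorem proposition5p2 (n k : ℕ) (hn : 1 ≤ n) (E : Submodule ℝ (Space n))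
    (hE : Module.finrank ℝ E = k) :
    (∀ K L : ConvexBody (Space n),
      (interior (K : Set (Space n))).Nonempty → (interior (L : Set (Space n))).Nonempty →
      volume ((K : Set (Space n)) ∩ -(L : Set (Space n))) =
        maxOverlap (K : Set (Space n)) (L : Set (Space n)) →
      IsSetLimit (scaledConvolutionBody (K : Set (Space n)) (L : Set (Space n))) (𝓝[<] (1 : ℝ))
        (limitingConvolutionBody (K : Set (Space n)) (L : Set (Space n))) ∧
      ((n + k).choose n : ℝ≥0∞) *
          ∫⁻ x : Eᗮ, sectionVolume E (K : Set (Space n)) x *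
            sectionVolume E (-(L : Set (Space n))) x /
              maxOverlap (K : Set (Space n)) (L : Set (Space n)) ∂(subspaceVolume Eᗮ) ≤
        sectionVolume E (limitingConvolutionBody (K : Set (Space n)) (L : Set (Space n))) 0) ∧
    (∀ K : ConvexBody (Space n), (interior (K : Set (Space n))).Nonempty →
      ((n + k).choose n : ℝ≥0∞) *
          (volume (K : Set (Space n)) / projectionVolume Eᗮ (K : Set (Space n))) ≤
        (n : ℝ≥0∞) ^ k * volume (K : Set (Space n)) ^ k *
          sectionVolume E (polarProjectionBody (K : Set (Space n))) 0) := by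
  have hn0 : n ≠ 0 := Nat.one_le_iff_ne_zero.1 hn
  subst hE
  refine ⟨fun K L hKi hLi hM => ?_, fun K hKi => ?_⟩
  · have hM0 := (maxOverlap_pos hKi hLi).ne'
    have hmono : ∀ ⦃θ θ' : ℝ⦄, 0 < θ → θ < θ' → θ' < 1 →
        scaledConvolutionBody (K : Set (Space n)) L θ ⊆ scaledConvolutionBody K L θ' :=
      fun θ θ' => scaledConvolutionBody_mono hn0 K.isCompact L.isCompact K.convex L.convex hM0 hM
    exact ⟨isSetLimit_of_mono hmono, choose_mul_lintegral_le hn0 E K.isCompact L.isCompact hM0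
      fun θ h0 h1 => subset_setLiminf_of_mono hmono h0 h1⟩
  · have hK0 : volume (K : Set (Space n)) ≠ 0 := (Measure.measure_pos_of_nonempty_interior _ hKi).ne'
    -- The containing set is `slowDirections` at rate n|K| rather than the limit body.
    have hbound := choose_mul_lintegral_le hn0 E K.isCompact K.isCompact.neg
      (by rwa [maxOverlap_neg]) fun θ h0 h1 =>
        scaledConvolutionBody_subset_slowDirections hn0 K.isCompact K.convex hK0 h0 h1
    rw [maxOverlap_neg, neg_neg] at hbound
    refine le_trans ?_
      (hbound.trans (sectionVolume_le_polarProjectionBody hn0 E K.isCompact K.convex hKi))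
    gcongr
    exact volume_div_projectionVolume_le E K.isCompact hK0
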